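/- **Setting.** Let $\Sigma\in\mathbb R^{p\times p}$ be positive definite, $\Theta=\Sigma^{-1}$, and let $G$ be a graph on $[p]=\{1,\dots,p\}$ with maximum degree $d$ such that $N(0,\Sigma)$ is a graphical model with respect to $G$, i.e. $X_i\perp X_j\mid X_{[p]\setminus\{i,j\}}$ for all non-adjacent $i\ne j$. Assume that the density $f$ of $N(0,\Sigma)$ is MTP$_2$: $f(x)f(y)\le f(x\wedge y)f(x\vee y)$ for all $x,y\in\mathbb R^p$, where $\wedge,\vee$ are the coordinatewise minimum and maximum. For a symmetric matrix $A$, nodes $i\neq j$, $S\subseteq[p]\setminus\{i,j\}$ and $M_S=S\cup\{i,j\}$, put $K=(A_{M_S,M_S})^{-1}$ and $\rho_{ij\mid S}(A)=-K_{ij}/\sqrt{K_{ii}K_{jj}}$; write $\rho_{ij\mid S}=\rho_{ij\mid S}(\Sigma)$. Let $x^{(1)},\dots,x^{(N)}$, $N\ge 1$, be i.i.d. observations from $N(0,\Sigma)$, let $\gamma\in(3/4,1)$, and let the batch size $M\le N$ be an integer with $|M-N^\gamma|<1$ (that is, $N^\gamma$ rounded to an integer). For every empirical partial correlation that is computed,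 an own batch $b$ is drawn uniformly from the $M$-element subsets of $\{1,\dots,N\}$, independently of the other batches and of the data, and $\hat\rho_{ij\mid S}=\rho_{ij\mid S}(\hat\Sigma_b)$ with $\hat\Sigma_b=\frac1M\sum_{n\in b}x^{(n)}(x^{(n)})^{T}$. **Algorithm.** Start with $\hat G$ the complete graph on $[p]$. In iterations $\ell=0,1,2,\dots$ consider, in any order, all ordered pairs $(i,j)$ that are adjacent in $\hat G$ with $|\mathrm{adj}_i(\hat G)\setminus\{j\}|\ge\ell$. For each of them go through all $S\subseteq \mathrm{adj}_i(\hat G)\setminus\{j\}$ with $|S|=\ell$ and all $k\in[p]\setminus(S\cup\{i,j\})$, and delete the edge $i-j$ from $\hat G$ as soon as $\hat\rho_{ij\mid S\cup\{k\}}<0$ (computed from the batch drawn for this test). Stop after the first iteration $\ell$ at whose end $|\mathrm{adj}_i(\hat G)\setminus\{j\}|<\ell$ for all ordered pairs $(i,j)$ adjacent in $\hat G$. **Theorem (false negative rate).** For all $d\in\mathbb N$ and $\sigma_{\min},\sigma_{\max}>0$ there is a constant $c_0>0$ such that for every $c_\rho\ge c_0$ there is $\tau>0$, depending only on $(c_\rho,\sigma_{\max},\sigma_{\min},d)$,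 with the following property. In the setting above (for any $p,N,\gamma,M,\Sigma,G$), assume 1. for every $S\subseteq[p]$ with $|S|\le d+4$, $\lambda_{\min}(\Sigma_S)\ge\sigma_{\min}$ and $\lambda_{\max}(\Sigma_S)\le\sigma_{\max}$; 2. for every edge $(i,j)$ of $G$, $\rho_{ij\mid[p]\setminus\{i,j\}}\ge c_\rho\sqrt{(\log p)/N^{3/4}}$. Then with probability at least $1-p^{-\tau}$ both of the following hold: every empirical partial correlation $\hat\rho_{ij\mid S}$ with $(i,j)$ an edge of $G$, $S\subseteq[p]\setminus\{i,j\}$ and $|S|\le d+2$ is positive; and, in whatever order the pairs are considered, the graph $\hat G$ at the end of iteration $\ell=d+1$ (the output, if the algorithm has stopped earlier) contains all edges of $G$. -/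

import Mathlib

open MeasureTheory ProbabilityTheory

noncomputable section

/-! ### Gaussian graphical models and total positivity -/

/-- The density of the centred Gaussian distribution with covariance matrix `Σ` (positive
definite) with respect to Lebesgue measure on `ℝ^p`. -/
def gaussianDensity {p : ℕ} (Sig : Matrix (Fin p) (Fin p) ℝ) (x : Fin p → ℝ) : ℝ :=
  (Real.sqrt ((2 * Real.pi) ^ p * Sig.det))⁻¹ * Real.exp (-(1 / 2) * (x ⬝ᵥ (Sig⁻¹.mulVec x)))

/-- Multivariate total positivity of order two of a density `f` on `ℝ^p`; `⊓` and `⊔` are the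
coordinatewise minimum and maximum. -/
def IsMTP2 {p : ℕ} (f : (Fin p → ℝ) → ℝ) : Prop :=
  ∀ x y : Fin p → ℝ, f x * f y ≤ f (x ⊓ y) * f (x ⊔ y)

/-- `P` forms an undirected graphical model with respect to `G`: for every non-adjacent pair
`i ≠ j`, the coordinates `X_i` and `X_j` are conditionally independent given all the others. -/
def IsGraphicalModel {p : ℕ} (G : SimpleGraph (Fin p)) (P : Measure (EuclideanSpace ℝ (Fin p)))
    [IsFiniteMeasure P] : Prop :=
  ∀ i j : Fin p, i ≠ j → ¬ G.Adj i j →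
    CondIndepFun
      (MeasurableSpace.comap
        (fun (x : EuclideanSpace ℝ (Fin p)) (k : {k : Fin p // k ≠ i ∧ k ≠ j}) => x k.1)
        inferInstance)
      (Measurable.comap_le (by fun_prop))
      (fun x : EuclideanSpace ℝ (Fin p) => x i) (fun x : EuclideanSpace ℝ (Fin p) => x j) P

/-- The principal submatrix of `A` with rows and columns in `S`. -/
def principalSubmatrix {p : ℕ} (A : Matrix (Fin p) (Fin p) ℝ) (S : Finset (Fin p)) :
    Matrix S S ℝ :=
  A.submatrix Subtype.val Subtype.val

/-- The partial correlation coefficient of `i` and `j` given `S`, computed from the covariance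
matrix `A`: with `M = S ∪ {i, j}` and `K = (A_{M,M})⁻¹` it is `- K_ij / √(K_ii K_jj)`.
If `A_{M,M}` is singular, then `K = 0` by convention and the value is `0`. -/
def partialCorr {p : ℕ} (A : Matrix (Fin p) (Fin p) ℝ) (i j : Fin p) (S : Finset (Fin p)) : ℝ :=
  let K := (principalSubmatrix A (insert i (insert j S)))⁻¹
  have hi : i ∈ insert i (insert j S) := by simp
  have hj : j ∈ insert i (insert j S) := by simp
  (-(K ⟨i, hi⟩ ⟨j, hj⟩)) / Real.sqrt (K ⟨i, hi⟩ ⟨i, hi⟩ * K ⟨j, hj⟩ ⟨j, hj⟩)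

/-- The eigenvalue condition: for every set `S` of at most `d + 4` nodes, all the eigenvalues of
`Σ_S` lie in `[σmin, σmax]`. -/
def EigenCondition {p : ℕ} (Sig : Matrix (Fin p) (Fin p) ℝ) (d : ℕ) (smin smax : ℝ) : Prop :=
  ∀ S : Finset (Fin p), S.card ≤ d + 4 →
    ∀ ev ∈ spectrum ℝ (principalSubmatrix Sig S), smin ≤ ev ∧ ev ≤ smax

/-- The signal strength condition: for every edge `(i,j)` of `G`, the partial correlation given
all the remaining nodes is at least `c √(log p / N^{3/4})`. -/
def SignalCondition {p : ℕ} (Sig : Matrix (Fin p) (Fin p) ℝ) (G : SimpleGraph (Fin p)) (N : ℕ)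
    (c : ℝ) : Prop :=
  ∀ i j : Fin p, G.Adj i j →
    c * Real.sqrt (Real.log p / (N : ℝ) ^ (3 / 4 : ℝ)) ≤
      partialCorr Sig i j (Finset.univ \ {i, j})

/-! ### Empirical partial correlations on batches -/

/-- A label of an empirical partial correlation. The label `(i, j, S, some k)` is that of
`ρ̂_{ij | S ∪ {k}}`, as computed for the choice of `S` and `k`; the label `(i, j, S, none)` is
that of `ρ̂_{ij | S}` with no additional node. A separate batch is drawn for every label. -/
structure CITest (p : ℕ) where
  i : Fin p
  j : Fin p
  S : Finset (Fin p)
  k : Option (Fin p)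

/-- The conditioning set of a label. -/
def CITest.condSet {p : ℕ} (t : CITest p) : Finset (Fin p) :=
  t.S ∪ t.k.toFinset

/-- The sample covariance matrix of the observations `x n`, `n ∈ b` (the mean is known to be
zero). -/
def sampleCov {p N : ℕ} (x : Fin N → EuclideanSpace ℝ (Fin p)) (b : Finset (Fin N)) :
    Matrix (Fin p) (Fin p) ℝ :=
  Matrix.of fun u v => (b.card : ℝ)⁻¹ * ∑ n ∈ b, x n u * x n v

/-- The empirical partial correlation with label `t`, from the data `x` and the batches `B`. -/
def empPartialCorr {p N : ℕ} (x : Fin N → EuclideanSpace ℝ (Fin p))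
    (B : CITest p → Finset (Fin N)) (t : CITest p) : ℝ :=
  partialCorr (sampleCov x (B t)) t.i t.j t.condSet

/-! ### The algorithm

Inside the processing of one ordered pair `(i, j)` the current graph changes only when `i - j` is
deleted, and then the processing of the pair ends. So its outcome does not depend on the order in
which the `S` and `k` are chosen. The order in which the ordered pairs are chosen does matter, and
it is a parameter. -/

/-- `adj_i(H) \ {j}`. -/
def adjWithout {p : ℕ} (H : SimpleGraph (Fin p)) (i j : Fin p) : Finset (Fin p) :=
  open Classical in Finset.univ.filter fun k => H.Adj i k ∧ k ≠ j

/-- Some test of the pair `(i, j)` at level `ℓ` in the current graph `H` is negative. -/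
def HasNegativeTest {p : ℕ} (rho : CITest p → ℝ) (l : ℕ) (H : SimpleGraph (Fin p))
    (i j : Fin p) : Prop :=
  ∃ S : Finset (Fin p), S ⊆ adjWithout H i j ∧ S.card = l ∧
    ∃ k : Fin p, k ∉ S ∧ k ≠ i ∧ k ≠ j ∧ rho ⟨i, j, S, some k⟩ < 0

/-- Processing of the ordered pair `e = (i, j)` at level `ℓ`: if the pair is eligible (adjacent,
with `|adj_i(H) \ {j}| ≥ ℓ`) and one of its tests is negative, then the edge is deleted. -/
def processPair {p : ℕ} (rho : CITest p → ℝ) (l : ℕ) (H : SimpleGraph (Fin p))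
    (e : Fin p × Fin p) : SimpleGraph (Fin p) :=
  open Classical in
  if H.Adj e.1 e.2 ∧ l ≤ (adjWithout H e.1 e.2).card ∧ HasNegativeTest rho l H e.1 e.2 then
    H.deleteEdges {s(e.1, e.2)}
  else H

/-- One iteration, at level `ℓ`, that considers the ordered pairs in the given order. -/
def runIteration {p : ℕ} (rho : CITest p → ℝ) (l : ℕ) (order : List (Fin p × Fin p))
    (H : SimpleGraph (Fin p)) : SimpleGraph (Fin p) :=
  order.foldl (processPair rho l) H

/-- The stopping criterion after the iteration at level `ℓ`. -/
def StopCriterion {p : ℕ} (l : ℕ) (H : SimpleGraph (Fin p)) : Prop :=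
  ∀ i j : Fin p, H.Adj i j → (adjWithout H i j).card < l

/-- The graph at the end of iteration `ℓ`, when iteration `m` considers the ordered pairs in the
order `order m`. The algorithm starts from the complete graph; if it has stopped before iteration
`ℓ`, this is its output. -/
def graphAfter {p : ℕ} (rho : CITest p → ℝ) (order : ℕ → List (Fin p × Fin p)) :
    ℕ → SimpleGraph (Fin p)
  | 0 => runIteration rho 0 (order 0) ⊤
  | l + 1 =>
    open Classical in
    if StopCriterion l (graphAfter rho order l) then graphAfter rho order l
    else runIteration rho (l + 1) (order (l + 1)) (graphAfter rho order l)

/-- Each iteration considers every ordered pair exactly once (pairs that are not eligible when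
their turn comes are skipped: they stay ineligible, since edges are only ever deleted). -/
def IsValidOrder {p : ℕ} (order : ℕ → List (Fin p × Fin p)) : Prop :=
  ∀ l : ℕ, (order l).Nodup ∧ ∀ e : Fin p × Fin p, e ∈ order l

end

/-!
# No false negatives in the MTP₂ structure learning algorithm

The algorithm only deletes an edge after a negative test, and up to level `d + 1` a test conditions
on at most `d + 2` nodes. So once all empirical partial correlations of edges of `G` with such
conditioning sets are positive, no edge of `G` is ever deleted, whatever the order
(`le_graphAfter`), and only this positivity has to be shown with high probability.

*Population.* Evaluating the MTP₂ inequality at two coordinate vectors shows that `Σ⁻¹` has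
nonpositive off-diagonal entries (`offDiag_nonpos_of_isMTP2`). Removing one variable replaces the
precision matrix by its one-dimensional Schur complement, which for such matrices decreases all the
entries; by induction, every marginal precision matrix lies entrywise below the corresponding block
of `Σ⁻¹` (`exists_marginal_precision_le`). Hence `ρ_{ij|S} ≥ ρ_{ij|rest}`, and the signal strength
condition passes to every conditioning set (`partialCorr_compl_le`).

*Sample.* By the eigenvalue condition, if `Σ̂` is entrywise within a small multiple of
`r = c₀ √(log p / N^{3/4})` of `Σ` on `S ∪ {i, j}`, then `ρ̂_{ij|S}` has the same sign as `ρ_{ij|S}`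
(`partialCorr_pos_of_entrywise_close`). By polarization, the entries of `Σ̂ - Σ` are differences of
centred empirical second moments of one-dimensional Gaussians, for which a Chernoff bound holds
(`empirical_variance_deviation_le`); a random batch is handled by conditioning on its value
(`measureReal_random_index_le`). As the batch size is at least `N^{3/4} / 2`, a single test fails
with probability at most a constant times `p ^ (-(a + 1))`, where `a` can be made large by the
choice of `c₀`, and a union bound over the polynomially many tests gives failure probability at most
`p⁻¹`, that is, `τ = 1`.
-/

/-! ### Partial correlations under total positivity -/

theorem inv_principalSubmatrix_eq {p : ℕ} {A L : Matrix (Fin p) (Fin p) ℝ} {S : Finset (Fin p)}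
    (h : ∀ u ∈ S, ∀ v ∈ S, ∑ w ∈ S, A u w * L w v = if u = v then 1 else 0) :
    (principalSubmatrix A S)⁻¹ = principalSubmatrix L S := by
  apply Matrix.inv_eq_right_inv
  ext u v
  rw [Matrix.mul_apply, Matrix.one_apply]
  simp only [principalSubmatrix, Matrix.submatrix_apply]
  rw [Finset.sum_coe_sort S (fun w => A u w * L w v), h u u.2 v v.2]
  simp only [Subtype.ext_iff]

/-- The partial correlation can be computed from any matrix that inverts the relevant block. -/
theorem partialCorr_eq {p : ℕ} {A L : Matrix (Fin p) (Fin p) ℝ} {i j : Fin p}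
    {S : Finset (Fin p)}
    (h : ∀ u ∈ insert i (insert j S), ∀ v ∈ insert i (insert j S),
      ∑ w ∈ insert i (insert j S), A u w * L w v = if u = v then 1 else 0) :
    partialCorr A i j S = -L i j / Real.sqrt (L i i * L j j) := by
  simp only [partialCorr, inv_principalSubmatrix_eq h]
  rfl

theorem offDiag_nonpos_of_isMTP2 {p : ℕ} {Sig : Matrix (Fin p) (Fin p) ℝ} (hS : Sig.PosDef)
    (hM : IsMTP2 (gaussianDensity Sig)) {i j : Fin p} (hij : i ≠ j) : Sig⁻¹ i j ≤ 0 := by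
  have h := hM (Pi.single i 1) (Pi.single j 1)
  have h1 : (Pi.single i (1 : ℝ) ⊓ Pi.single j 1 : Fin p → ℝ) = 0 := by
    ext k
    by_cases hi : k = i
    · subst hi; simp [hij]
    · by_cases hj : k = j
      · subst hj; simp [hi]
      · simp [hi, hj]
  have h2 : (Pi.single i (1 : ℝ) ⊔ Pi.single j 1 : Fin p → ℝ) =
      Pi.single i 1 + Pi.single j 1 := by
    ext k
    by_cases hi : k = i
    · subst hi; simp [hij]
    · by_cases hj : k = j
      · subst hj; simp [hi]
      · simp [hi, hj]
  rw [h1, h2] at h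
  have hpos : 0 < (Real.sqrt ((2 * Real.pi) ^ p * Sig.det))⁻¹ :=
    inv_pos.2 (Real.sqrt_pos.2 (mul_pos (by positivity) hS.det_pos))
  unfold gaussianDensity at h
  have key : ∀ {c x y z w : ℝ}, 0 < c →
      c * Real.exp x * (c * Real.exp y) ≤ c * Real.exp z * (c * Real.exp w) →
      x + y ≤ z + w := by
    intro c x y z w hc hle
    rw [mul_mul_mul_comm c, mul_mul_mul_comm c (Real.exp z), ← Real.exp_add, ← Real.exp_add,
      mul_le_mul_iff_right₀ (mul_pos hc hc), Real.exp_le_exp] at hle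
    exact hle
  replace h := key hpos h
  have hsym : Sig⁻¹ j i = Sig⁻¹ i j := by
    simpa using hS.inv.isHermitian.apply i j
  simp [Matrix.mulVec_add, hsym] at h
  linarith

/-- Marginalising a Gaussian vector one coordinate at a time: the inverse of the principal
submatrix on `S` minus `k` is the one-dimensional Schur complement of the inverse on `S`. -/
theorem schur_erase {p : ℕ} {A L : Matrix (Fin p) (Fin p) ℝ} {S : Finset (Fin p)} {k : Fin p}
    (hk : k ∈ S) (hL : L k k ≠ 0)
    (h : ∀ u ∈ S, ∀ v ∈ S, ∑ w ∈ S, A u w * L w v = if u = v then 1 else 0) :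
    ∀ u ∈ S.erase k, ∀ v ∈ S.erase k,
      ∑ w ∈ S.erase k, A u w * (L w v - L w k * L k v / L k k) = if u = v then 1 else 0 := by
  intro u hu v hv
  have hk0 : A u k * (L k v - L k k * L k v / L k k) = 0 := by
    rw [mul_div_assoc, mul_div_cancel₀ _ hL]; simp
  have e1 := h u (Finset.mem_of_mem_erase hu) v (Finset.mem_of_mem_erase hv)
  have e2 := h u (Finset.mem_of_mem_erase hu) k hk
  rw [if_neg (Finset.ne_of_mem_erase hu)] at e2
  rw [Finset.sum_erase S (f := fun w => A u w * (L w v - L w k * L k v / L k k)) hk0, ← e1]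
  have : ∀ w, A u w * (L w v - L w k * L k v / L k k) =
      A u w * L w v - A u w * L w k * (L k v / L k k) := fun w => by ring
  simp only [this, Finset.sum_sub_distrib, ← Finset.sum_mul, e2]
  ring

theorem principalSubmatrix_posDef {p : ℕ} {A : Matrix (Fin p) (Fin p) ℝ} (hA : A.PosDef)
    (S : Finset (Fin p)) : (principalSubmatrix A S).PosDef :=
  hA.submatrix Subtype.val_injective

/-- If the precision matrix has nonpositive off-diagonal entries, then the precision matrix of
every marginal is entrywise at most the corresponding block of the full precision matrix. -/
theorem exists_marginal_precision_le {p : ℕ} {Sig : Matrix (Fin p) (Fin p) ℝ} (hS : Sig.PosDef)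
    (hoff : ∀ i j, i ≠ j → Sig⁻¹ i j ≤ 0) (T : Finset (Fin p)) :
    ∃ L : Matrix (Fin p) (Fin p) ℝ,
      (∀ u ∈ Finset.univ \ T, ∀ v ∈ Finset.univ \ T,
        ∑ w ∈ Finset.univ \ T, Sig u w * L w v = if u = v then 1 else 0) ∧
      (∀ u ∈ Finset.univ \ T, 0 < L u u) ∧
      ∀ u ∈ Finset.univ \ T, ∀ v ∈ Finset.univ \ T, L u v ≤ Sig⁻¹ u v := by
  suffices H : ∃ L : Matrix (Fin p) (Fin p) ℝ,
      (∀ u ∈ Finset.univ \ T, ∀ v ∈ Finset.univ \ T,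
        ∑ w ∈ Finset.univ \ T, Sig u w * L w v = if u = v then 1 else 0) ∧
      ∀ u ∈ Finset.univ \ T, ∀ v ∈ Finset.univ \ T, L u v ≤ Sig⁻¹ u v by
    obtain ⟨L, h1, h2⟩ := H
    refine ⟨L, h1, fun u hu => ?_, h2⟩
    have h := (principalSubmatrix_posDef hS (Finset.univ \ T)).inv.diag_pos (i := ⟨u, hu⟩)
    rwa [inv_principalSubmatrix_eq h1] at h
  induction T using Finset.induction_on with
  | empty =>
    refine ⟨Sig⁻¹, fun u _ v _ => ?_, fun _ _ _ _ => le_rfl⟩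
    have := Matrix.mul_nonsing_inv Sig hS.det_pos.ne'.isUnit
    have := congrFun (congrFun this u) v
    simpa [Matrix.mul_apply, Matrix.one_apply] using this
  | insert k T hk ih =>
    obtain ⟨L, h1, h2⟩ := ih
    have hkT : k ∈ Finset.univ \ T := by simp [hk]
    have hkk : 0 < L k k := by
      have h := (principalSubmatrix_posDef hS (Finset.univ \ T)).inv.diag_pos (i := ⟨k, hkT⟩)
      rwa [inv_principalSubmatrix_eq h1] at h
    have hset : Finset.univ \ insert k T = (Finset.univ \ T).erase k := by
      ext x; simp [not_or]
    rw [hset]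
    refine ⟨Matrix.of fun u v => L u v - L u k * L k v / L k k,
      fun u hu v hv => by simpa using schur_erase hkT hkk.ne' h1 u hu v hv,
      fun u hu v hv => ?_⟩
    have hu' := Finset.mem_of_mem_erase hu
    have hv' := Finset.mem_of_mem_erase hv
    have a := (h2 u hu' k hkT).trans (hoff u k (Finset.ne_of_mem_erase hu))
    have b := (h2 k hkT v hv').trans (hoff k v (Finset.ne_of_mem_erase hv).symm)
    have c : 0 ≤ L u k * L k v / L k k := div_nonneg (mul_nonneg_of_nonpos_of_nonpos a b) hkk.le
    have := h2 u hu' v hv'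
    simp only [Matrix.of_apply]
    linarith

/-- Under total positivity, conditioning on fewer nodes can only increase a partial
correlation. -/
theorem partialCorr_compl_le {p : ℕ} {Sig : Matrix (Fin p) (Fin p) ℝ} (hS : Sig.PosDef)
    (hoff : ∀ i j, i ≠ j → Sig⁻¹ i j ≤ 0) {i j : Fin p} (hij : i ≠ j) (S : Finset (Fin p)) :
    partialCorr Sig i j (Finset.univ \ {i, j}) ≤ partialCorr Sig i j S := by
  have huniv : insert i (insert j (Finset.univ \ {i, j})) = (Finset.univ : Finset (Fin p)) := by
    ext x; simp only [Finset.mem_insert, Finset.mem_sdiff, Finset.mem_univ, true_and,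
      Finset.mem_singleton, iff_true]; tauto
  have e1 : partialCorr Sig i j (Finset.univ \ {i, j}) =
      -Sig⁻¹ i j / Real.sqrt (Sig⁻¹ i i * Sig⁻¹ j j) := by
    apply partialCorr_eq
    rw [huniv]
    intro u _ v _
    have := congrFun (congrFun (Matrix.mul_nonsing_inv Sig hS.det_pos.ne'.isUnit) u) v
    simpa [Matrix.mul_apply, Matrix.one_apply] using this
  obtain ⟨L, h1, h2, h3⟩ :=
    exists_marginal_precision_le hS hoff (Finset.univ \ insert i (insert j S))
  rw [sdiff_sdiff_right_self, Finset.inf_eq_inter, Finset.univ_inter] at h1 h2 h3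
  have hi : i ∈ insert i (insert j S) := by simp
  have hj : j ∈ insert i (insert j S) := by simp
  rw [e1, partialCorr_eq h1]
  have hii := h2 i hi
  have hjj := h2 j hj
  have := hoff i j hij
  have := h3 i hi j hj
  gcongr
  · linarith
  · exact hii.le.trans (h3 i hi i hi)
  · exact h3 i hi i hi
  · exact h3 j hj j hj

theorem partialCorr_le_one {p : ℕ} {Sig : Matrix (Fin p) (Fin p) ℝ} (hS : Sig.PosDef)
    {i j : Fin p} (hij : i ≠ j) (S : Finset (Fin p)) : partialCorr Sig i j S ≤ 1 := by
  unfold partialCorr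
  have hP := (principalSubmatrix_posDef hS (insert i (insert j S))).inv
  set K := (principalSubmatrix Sig (insert i (insert j S)))⁻¹
  have hne : (⟨i, by simp⟩ : {x // x ∈ insert i (insert j S)}) ≠ ⟨j, by simp⟩ := by
    simpa [Subtype.ext_iff] using hij
  set a : {x // x ∈ insert i (insert j S)} := ⟨i, by simp⟩
  set b : {x // x ∈ insert i (insert j S)} := ⟨j, by simp⟩
  have ha := hP.diag_pos (i := a)
  have hb := hP.diag_pos (i := b)
  have hsym : K b a = K a b := by simpa using hP.isHermitian.apply a b
  rw [div_le_one (Real.sqrt_pos.2 (mul_pos ha hb))]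
  apply Real.le_sqrt_of_sq_le
  -- the quadratic form of `K` at this vector is `K_bb` times its `2 × 2` minor on `{a, b}`
  have h := hP.posSemidef.dotProduct_mulVec_nonneg (Pi.single a (K b b) - Pi.single b (K a b))
  simp [Matrix.mulVec_sub, hsym, Matrix.mulVec_single] at h
  nlinarith [h]

/-! ### Stability of the sign of a partial correlation -/

/-- The operator norm of a matrix is at most its size times its largest entry. -/
theorem abs_dotProduct_mulVec_le {ι : Type*} [Fintype ι] {E : Matrix ι ι ℝ} {ε : ℝ}
    (hε0 : 0 ≤ ε) (hε : ∀ u v, |E u v| ≤ ε) (x y : ι → ℝ) :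
    |x ⬝ᵥ E.mulVec y| ≤ Fintype.card ι * ε * (√(x ⬝ᵥ x) * √(y ⬝ᵥ y)) := by
  have l1 : ∀ z : ι → ℝ, ∑ u, |z u| ≤ √(Fintype.card ι) * √(z ⬝ᵥ z) := by
    intro z
    rw [← Real.sqrt_mul (Nat.cast_nonneg _)]
    apply Real.le_sqrt_of_sq_le
    have := sq_sum_le_card_mul_sum_sq (s := Finset.univ) (f := fun u => |z u|)
    simpa [dotProduct, sq_abs, ← sq] using this
  calc |x ⬝ᵥ E.mulVec y| = |∑ u, ∑ v, x u * (E u v * y v)| := by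
        simp [dotProduct, Matrix.mulVec, Finset.mul_sum]
    _ ≤ ∑ u, ∑ v, |x u * (E u v * y v)| :=
        (Finset.abs_sum_le_sum_abs _ _).trans
          (Finset.sum_le_sum fun u _ => Finset.abs_sum_le_sum_abs _ _)
    _ ≤ ∑ u, ∑ v, |x u| * (ε * |y v|) := by
        refine Finset.sum_le_sum fun u _ => Finset.sum_le_sum fun v _ => ?_
        rw [abs_mul, abs_mul]
        gcongr
        exact hε u v
    _ = ε * ((∑ u, |x u|) * ∑ v, |y v|) := by
        rw [Finset.sum_mul_sum, Finset.mul_sum]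
        refine Finset.sum_congr rfl fun u _ => ?_
        rw [Finset.mul_sum]
        exact Finset.sum_congr rfl fun v _ => by ring
    _ ≤ ε * ((√(Fintype.card ι) * √(x ⬝ᵥ x)) * (√(Fintype.card ι) * √(y ⬝ᵥ y))) := by
        gcongr
        · exact l1 x
        · exact l1 y
    _ = _ := by
        have := Real.mul_self_sqrt (Nat.cast_nonneg (α := ℝ) (Fintype.card ι))
        linear_combination ε * √(x ⬝ᵥ x) * √(y ⬝ᵥ y) * this

/-- If the quadratic form of `B` is at least `s`, then the columns of `B⁻¹` have Euclidean norm at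
most `1 / s`. -/
theorem sqrt_dotProduct_inv_single_le {ι : Type*} [Fintype ι] [DecidableEq ι]
    {B : Matrix ι ι ℝ} {s : ℝ} (hs : 0 < s) (hB : IsUnit B.det)
    (hBs : ∀ x : ι → ℝ, s * (x ⬝ᵥ x) ≤ x ⬝ᵥ B.mulVec x) (j : ι) :
    √((B⁻¹.mulVec (Pi.single j 1)) ⬝ᵥ (B⁻¹.mulVec (Pi.single j 1))) ≤ 1 / s := by
  set y := B⁻¹.mulVec (Pi.single j 1) with hy
  have h := hBs y
  have hBy : B.mulVec y = Pi.single j 1 := by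
    rw [hy, Matrix.mulVec_mulVec, Matrix.mul_nonsing_inv B hB, Matrix.one_mulVec]
  rw [hBy, dotProduct_single_one] at h
  have hyy : 0 ≤ y ⬝ᵥ y := Finset.sum_nonneg fun _ _ => mul_self_nonneg _
  have hle : y j ≤ √(y ⬝ᵥ y) := by
    apply Real.le_sqrt_of_sq_le
    rw [sq]
    exact Finset.single_le_sum (f := fun u => y u * y u) (fun u _ => mul_self_nonneg _)
      (Finset.mem_univ j)
  rw [le_div_iff₀ hs]
  rcases (Real.sqrt_nonneg (y ⬝ᵥ y)).eq_or_lt with h0 | h0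
  · rw [← h0]; simp
  · have := Real.mul_self_sqrt hyy
    refine le_of_mul_le_mul_left ?_ h0
    nlinarith

/-- Conditional variances are at most marginal ones: `(A⁻¹)ᵢᵢ ≥ 1 / Aᵢᵢ ≥ 1 / l`. -/
theorem inv_le_precision_diag {ι : Type*} [Fintype ι] [DecidableEq ι] {A : Matrix ι ι ℝ} {l : ℝ}
    (hA : A.PosDef) (hl : 0 < l) (hAl : ∀ i, A i i ≤ l) (i : ι) : l⁻¹ ≤ A⁻¹ i i := by
  have hdet : IsUnit A.det := hA.det_pos.ne'.isUnit
  have hAx : A.mulVec (A⁻¹.mulVec (Pi.single i 1)) = Pi.single i 1 := by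
    rw [Matrix.mulVec_mulVec, Matrix.mul_nonsing_inv A hdet, Matrix.one_mulVec]
  have hsym : A.col i = A.row i := by
    ext k; simpa using hA.isHermitian.apply i k
  set x := A⁻¹.mulVec (Pi.single i 1) with hx
  have hxi : x i = A⁻¹ i i := by simp [hx]
  have hcross : x ⬝ᵥ A.col i = 1 := by
    rw [hsym, dotProduct_comm]
    have h := congrFun hAx i
    rwa [Pi.single_eq_same] at h
  have hz : A.mulVec (x - l⁻¹ • Pi.single i 1) = Pi.single i 1 - l⁻¹ • A.col i := by
    rw [Matrix.mulVec_sub, hAx, Matrix.mulVec_smul, Matrix.mulVec_single_one]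
  -- `x` is the column `i` of `A⁻¹`; the quadratic form at `x - l⁻¹ eᵢ` is
  -- `(A⁻¹)ᵢᵢ - 2 l⁻¹ + l⁻² Aᵢᵢ`
  have h := hA.posSemidef.dotProduct_mulVec_nonneg (x - l⁻¹ • Pi.single i 1)
  rw [star_trivial, hz, dotProduct_sub, dotProduct_single_one, dotProduct_smul, sub_dotProduct,
    smul_dotProduct, single_one_dotProduct, hcross] at h
  simp only [Pi.sub_apply, Pi.smul_apply, smul_eq_mul, Pi.single_eq_same, hxi,
    Matrix.col_apply] at h
  have h2 : l⁻¹ * (A i i * l⁻¹) ≤ l⁻¹ := by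
    have := hAl i
    have hl' : 0 < l⁻¹ := inv_pos.2 hl
    calc l⁻¹ * (A i i * l⁻¹) ≤ l⁻¹ * (l * l⁻¹) := by gcongr
      _ = l⁻¹ := by field_simp
  linarith

/-- Stability of the sign of a precision entry: if `B` is entrywise `ε`-close to `A`, and the
partial correlation computed from `A` is at least `ρ`, with `ε` small compared to `ρ`, then the one
computed from `B` is still positive. -/
theorem posDef_and_inv_neg_of_entrywise_close {ι : Type*} [Fintype ι] [DecidableEq ι]
    {A B : Matrix ι ι ℝ} {m s l ρ ε : ℝ} (hm : (Fintype.card ι : ℝ) ≤ m) (hs : 0 < s) (hl : 0 < l)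
    (hρ0 : 0 ≤ ρ) (hε0 : 0 ≤ ε)
    (hA : A.PosDef) (hAs : ∀ x : ι → ℝ, s * (x ⬝ᵥ x) ≤ x ⬝ᵥ A.mulVec x) (hAl : ∀ i, A i i ≤ l)
    (hB : B.IsHermitian) (hε : ∀ u v, |B u v - A u v| ≤ ε) (hmε : m * ε ≤ s / 2) {i j : ι}
    (hρ : ρ ≤ -(A⁻¹ i j) / √(A⁻¹ i i * A⁻¹ j j)) (h : 2 * m * ε * l < ρ * s ^ 2) :
    B.PosDef ∧ B⁻¹ i j < 0 := by
  have hAdet : IsUnit A.det := hA.det_pos.ne'.isUnit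
  have hE : ∀ x y : ι → ℝ, |x ⬝ᵥ B.mulVec y - x ⬝ᵥ A.mulVec y| ≤
      m * ε * (√(x ⬝ᵥ x) * √(y ⬝ᵥ y)) := by
    intro x y
    rw [← dotProduct_sub, ← Matrix.sub_mulVec]
    refine (abs_dotProduct_mulVec_le hε0 (fun u v => hε u v) x y).trans ?_
    gcongr
  have hBs : ∀ x : ι → ℝ, s / 2 * (x ⬝ᵥ x) ≤ x ⬝ᵥ B.mulVec x := by
    intro x
    have h1 := (abs_le.1 (hE x x)).1
    have hxx : 0 ≤ x ⬝ᵥ x := Finset.sum_nonneg fun _ _ => mul_self_nonneg _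
    rw [Real.mul_self_sqrt hxx] at h1
    have h2 := hAs x
    nlinarith [mul_le_mul_of_nonneg_right hmε hxx]
  have hBpd : B.PosDef := by
    refine Matrix.PosDef.of_dotProduct_mulVec_pos hB fun x hx => ?_
    have hxx : 0 < x ⬝ᵥ x :=
      lt_of_le_of_ne (Finset.sum_nonneg fun _ _ => mul_self_nonneg _)
        fun h => hx (dotProduct_self_eq_zero.1 h.symm)
    rw [star_trivial]
    exact lt_of_lt_of_le (by positivity) (hBs x)
  have hBdet : IsUnit B.det := hBpd.det_pos.ne'.isUnit
  refine ⟨hBpd, ?_⟩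
  set x := A⁻¹.mulVec (Pi.single i 1) with hx
  set y := B⁻¹.mulVec (Pi.single j 1) with hy
  have hxn : √(x ⬝ᵥ x) ≤ 1 / s := sqrt_dotProduct_inv_single_le hs hAdet hAs i
  have hyn : √(y ⬝ᵥ y) ≤ 1 / (s / 2) :=
    sqrt_dotProduct_inv_single_le (by positivity) hBdet hBs j
  -- `A⁻¹ᵢⱼ - B⁻¹ᵢⱼ = xᵀ (B - A) y`, with `x` and `y` columns of `A⁻¹` and `B⁻¹`
  have hBy : x ⬝ᵥ B.mulVec y = A⁻¹ i j := by
    rw [hy, Matrix.mulVec_mulVec, Matrix.mul_nonsing_inv B hBdet, Matrix.one_mulVec,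
      dotProduct_single_one, hx]
    simpa using hA.inv.isHermitian.apply i j
  have hAy : x ⬝ᵥ A.mulVec y = B⁻¹ i j := by
    have hAt : A.transpose = A := by simpa using hA.isHermitian.eq
    rw [Matrix.dotProduct_mulVec, ← Matrix.mulVec_transpose, hAt, hx, Matrix.mulVec_mulVec,
      Matrix.mul_nonsing_inv A hAdet, Matrix.one_mulVec, single_one_dotProduct, hy]
    simp
  have hmain := (abs_le.1 (hE x y)).1
  rw [hBy, hAy] at hmain
  have hm0 : 0 ≤ m := (Nat.cast_nonneg _).trans hm
  have hbound : m * ε * (√(x ⬝ᵥ x) * √(y ⬝ᵥ y)) ≤ m * ε * (1 / s * (1 / (s / 2))) := by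
    gcongr
  have hii := inv_le_precision_diag hA hl hAl i
  have hjj := inv_le_precision_diag hA hl hAl j
  have hl' : 0 < l⁻¹ := inv_pos.2 hl
  have hsq : l⁻¹ ≤ √(A⁻¹ i i * A⁻¹ j j) := by
    apply Real.le_sqrt_of_sq_le
    rw [sq]
    exact mul_le_mul hii hjj hl'.le (hl'.le.trans hii)
  rw [le_div_iff₀ (hl'.trans_le hsq)] at hρ
  have h3 : ρ * l⁻¹ ≤ -(A⁻¹ i j) := (mul_le_mul_of_nonneg_left hsq hρ0).trans hρ
  have h4 : m * ε * (1 / s * (1 / (s / 2))) < ρ * l⁻¹ := by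
    rw [← div_eq_mul_inv, lt_div_iff₀ hl]
    have : m * ε * (1 / s * (1 / (s / 2))) * l = 2 * m * ε * l / s ^ 2 := by
      field_simp
    rw [this, div_lt_iff₀ (by positivity)]
    exact h
  linarith

theorem dotProduct_mulVec_ge_of_spectrum {ι : Type*} [Fintype ι] [DecidableEq ι]
    {A : Matrix ι ι ℝ} (hA : A.IsHermitian) {s : ℝ} (h : ∀ ev ∈ spectrum ℝ A, s ≤ ev)
    (x : ι → ℝ) : s * (x ⬝ᵥ x) ≤ x ⬝ᵥ A.mulVec x := by
  have hpsd : (A - algebraMap ℝ (Matrix ι ι ℝ) s).PosSemidef := by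
    rw [Matrix.posSemidef_iff_isHermitian_and_spectrum_nonneg]
    refine ⟨hA.sub ?_, ?_⟩
    · rw [Algebra.algebraMap_eq_smul_one]
      simp [Matrix.IsHermitian]
    · rw [← spectrum.sub_singleton_eq, Set.sub_singleton]
      rintro _ ⟨ev, hev, rfl⟩
      simpa using h ev hev
  have h := hpsd.dotProduct_mulVec_nonneg x
  rw [star_trivial, Matrix.sub_mulVec, dotProduct_sub, Algebra.algebraMap_eq_smul_one,
    Matrix.smul_mulVec, Matrix.one_mulVec, dotProduct_smul, smul_eq_mul] at h
  linarith

theorem diag_le_of_spectrum {ι : Type*} [Fintype ι] [DecidableEq ι]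
    {A : Matrix ι ι ℝ} (hA : A.IsHermitian) {l : ℝ} (h : ∀ ev ∈ spectrum ℝ A, ev ≤ l)
    (i : ι) : A i i ≤ l := by
  have h := dotProduct_mulVec_ge_of_spectrum (A := -A) (s := -l) hA.neg (fun ev hev => by
    rw [← spectrum.neg_eq, Set.mem_neg] at hev
    linarith [h _ hev]) (Pi.single i 1)
  rw [Matrix.neg_mulVec, dotProduct_neg, Matrix.mulVec_single_one, single_one_dotProduct,
    single_one_dotProduct] at h
  simpa using h

theorem partialCorr_pos_of_entrywise_close {p : ℕ} {A B : Matrix (Fin p) (Fin p) ℝ}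
    {m s l ρ ε : ℝ} (hs : 0 < s) (hl : 0 < l) (hρ0 : 0 ≤ ρ) (hε0 : 0 ≤ ε) (hA : A.PosDef)
    (hB : B.IsHermitian) {i j : Fin p} {S : Finset (Fin p)}
    (hm : ((insert i (insert j S)).card : ℝ) ≤ m)
    (hev : ∀ ev ∈ spectrum ℝ (principalSubmatrix A (insert i (insert j S))), s ≤ ev ∧ ev ≤ l)
    (hε : ∀ u ∈ insert i (insert j S), ∀ v ∈ insert i (insert j S), |B u v - A u v| ≤ ε)
    (hmε : m * ε ≤ s / 2) (hρ : ρ ≤ partialCorr A i j S) (h : 2 * m * ε * l < ρ * s ^ 2) :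
    0 < partialCorr B i j S := by
  have hAS := principalSubmatrix_posDef hA (insert i (insert j S))
  obtain ⟨h1, h2⟩ := posDef_and_inv_neg_of_entrywise_close
    (B := principalSubmatrix B (insert i (insert j S))) (by rwa [Fintype.card_coe]) hs hl hρ0 hε0 hAS
    (dotProduct_mulVec_ge_of_spectrum hAS.isHermitian fun ev he => (hev ev he).1)
    (diag_le_of_spectrum hAS.isHermitian fun ev he => (hev ev he).2)
    (hB.submatrix _) (fun u v => hε u u.2 v v.2) hmε hρ h
  unfold partialCorr
  exact div_pos (neg_pos.2 h2) (Real.sqrt_pos.2 (mul_pos h1.inv.diag_pos h1.inv.diag_pos))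

/-! ### Concentration of empirical second moments of Gaussian variables -/

/-- Sub-Gaussian type bound for the moment generating function of a centred `χ²₁` variable, at
`x = 2tv`. -/
theorem inv_sqrt_one_sub_mul_exp_le {x : ℝ} (hx : |x| ≤ 1 / 2) :
    (√(1 - x))⁻¹ * Real.exp (-x / 2) ≤ Real.exp (x ^ 2 / 2) := by
  obtain ⟨h1, h2⟩ := abs_le.1 hx
  have hpos : 0 < 1 - x := by linarith
  -- equivalent, after squaring, to `exp (-x - x ^ 2) ≤ 1 - x`
  have hkey : Real.exp (-x - x ^ 2) ≤ 1 - x := by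
    rw [← neg_add', Real.exp_neg, inv_le_iff_one_le_mul₀ (Real.exp_pos _)]
    rcases le_total 0 x with h0 | h0
    · calc (1 : ℝ) ≤ (1 - x) * (1 + (x + x ^ 2) + (x + x ^ 2) ^ 2 / 2) := by
            have : 0 ≤ (1 + x) * (1 - x ^ 2) - 2 * x := by
              nlinarith [mul_nonneg h0 (sub_nonneg.2 h2), mul_nonneg (mul_nonneg h0 h0)
                (sub_nonneg.2 h2)]
            nlinarith [mul_nonneg (mul_nonneg h0 h0) this]
        _ ≤ _ := by
            gcongr
            exact Real.quadratic_le_exp_of_nonneg (by positivity)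
    · calc (1 : ℝ) ≤ (1 - x) * (x + x ^ 2 + 1) := by
            nlinarith [mul_nonneg (mul_self_nonneg x) (neg_nonneg.2 h0)]
        _ ≤ _ := by
            gcongr
            exact Real.add_one_le_exp _
  have h9 : Real.exp ((-x - x ^ 2) / 2) ≤ √(1 - x) := by
    apply Real.le_sqrt_of_sq_le
    rw [← Real.exp_nat_mul]
    refine le_trans (le_of_eq ?_) hkey
    congr 1; push_cast; ring
  rw [inv_mul_le_iff₀ (Real.sqrt_pos.2 hpos)]
  calc Real.exp (-x / 2) = Real.exp ((-x - x ^ 2) / 2) * Real.exp (x ^ 2 / 2) := by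
        rw [← Real.exp_add]; congr 1; ring
    _ ≤ _ := by gcongr

open scoped NNReal in
theorem mgf_sq_gaussianReal {v : ℝ≥0} {t : ℝ} (ht : 2 * t * v < 1) :
    mgf (fun y => y ^ 2) (gaussianReal 0 v) t = (√(1 - 2 * t * v))⁻¹ := by
  rcases eq_or_ne v 0 with rfl | hv
  · simp [mgf]
  have hv' : (0 : ℝ) < v := by exact_mod_cast pos_iff_ne_zero.2 hv
  have hpos : 0 < 1 - 2 * t * v := by linarith
  rw [mgf, integral_gaussianReal_eq_integral_smul hv]
  have : ∀ x : ℝ, gaussianPDFReal 0 v x • Real.exp (t * x ^ 2) =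
      (√(2 * Real.pi * v))⁻¹ * Real.exp (-((1 - 2 * t * v) / (2 * v)) * x ^ 2) := by
    intro x
    rw [gaussianPDFReal, smul_eq_mul, mul_assoc, ← Real.exp_add]
    congr 2
    field_simp
    ring
  simp_rw [this]
  rw [integral_const_mul, integral_gaussian, ← Real.sqrt_inv, ← Real.sqrt_mul (by positivity),
    ← Real.sqrt_inv]
  congr 1
  field_simp

open scoped NNReal in
theorem mgf_sum_sq_gaussian_le {Ω ι : Type*} [MeasurableSpace Ω] {P : Measure Ω}
    {Y : ι → Ω → ℝ} {v : ℝ≥0} (hY : ∀ n, HasLaw (Y n) (gaussianReal 0 v) P) (hind : iIndepFun Y P)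
    {t : ℝ} (ht : |2 * t * v| ≤ 1 / 2) (b : Finset ι) :
    Integrable (fun ω => Real.exp (t * ∑ n ∈ b, (Y n ω ^ 2 - v))) P ∧
      mgf (fun ω => ∑ n ∈ b, (Y n ω ^ 2 - v)) P t ≤ Real.exp (b.card * (2 * (t * v) ^ 2)) := by
  have ht1 : 2 * t * v < 1 := by linarith [(abs_le.1 ht).2]
  have hone : ∀ n, mgf (fun ω => Y n ω ^ 2 - v) P t =
      (√(1 - 2 * t * v))⁻¹ * Real.exp (-(2 * t * v) / 2) := by
    intro n
    simp_rw [sub_eq_add_neg (Y n _ ^ 2)]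
    rw [mgf_add_const, ← mgf_sq_gaussianReal ht1]
    congr 2
    · have h := (hY n).integral_comp (f := fun y => Real.exp (t * y ^ 2)) (by fun_prop)
      simpa [mgf, Function.comp_def] using h
    · ring
  have hmeas : ∀ n, AEMeasurable (fun ω => Y n ω ^ 2 - (v : ℝ)) P := fun n =>
    ((hY n).aemeasurable.pow_const 2).sub_const _
  have hind' : iIndepFun (fun n ω => Y n ω ^ 2 - (v : ℝ)) P :=
    hind.comp (fun _ y => y ^ 2 - (v : ℝ)) (fun _ => by fun_prop)
  have hsum : mgf (fun ω => ∑ n ∈ b, (Y n ω ^ 2 - v)) P t =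
      ((√(1 - 2 * t * v))⁻¹ * Real.exp (-(2 * t * v) / 2)) ^ b.card := by
    have h := hind'.mgf_sum₀ (t := t) hmeas b
    rw [Finset.prod_congr rfl fun n _ => hone n, Finset.prod_const] at h
    rw [← h]
    congr 1
    ext ω
    simp
  have hpos : 0 < (√(1 - 2 * t * v))⁻¹ * Real.exp (-(2 * t * v) / 2) :=
    mul_pos (inv_pos.2 (Real.sqrt_pos.2 (by linarith))) (Real.exp_pos _)
  constructor
  · -- a Bochner integral that is not zero is not a junk value
    apply Integrable.of_integral_ne_zero
    change mgf (fun ω => ∑ n ∈ b, (Y n ω ^ 2 - v)) P t ≠ 0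
    rw [hsum]
    positivity
  · rw [hsum, Real.exp_nat_mul]
    gcongr
    refine (inv_sqrt_one_sub_mul_exp_le ht).trans (le_of_eq ?_)
    congr 1; ring

open scoped NNReal in
/-- Two-sided Bernstein bound for the empirical second moment of independent centred Gaussian
variables of variance `v ≤ V`. -/
theorem empirical_variance_deviation_le {Ω ι : Type*} [MeasurableSpace Ω] {P : Measure Ω}
    [IsProbabilityMeasure P] {Y : ι → Ω → ℝ} {v : ℝ≥0}
    (hY : ∀ n, HasLaw (Y n) (gaussianReal 0 v) P) (hind : iIndepFun Y P)
    {V ε : ℝ} (hvV : v ≤ V) (hV : 0 < V) (hε : 0 < ε) (hεV : ε ≤ V) {b : Finset ι}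
    (hb : 0 < b.card) :
    P.real {ω | ε ≤ |(b.card : ℝ)⁻¹ * ∑ n ∈ b, Y n ω ^ 2 - v|} ≤
      2 * Real.exp (-(b.card * ε ^ 2 / (8 * V ^ 2))) := by
  have hb' : (0 : ℝ) < b.card := by exact_mod_cast hb
  have hv0 : (0 : ℝ) ≤ v := v.2
  -- the exponent `t = ε / (4 V²)` optimises the Chernoff bound `exp (-M t ε + 2 M t² V²)`
  set t : ℝ := ε / (4 * V ^ 2) with ht
  have ht0 : 0 ≤ t := by positivity
  have htv : t * v ≤ ε / (4 * V) := by
    calc t * v ≤ t * V := by gcongr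
      _ = ε / (4 * V) := by rw [ht]; field_simp
  have htv0 : 0 ≤ t * v := by positivity
  have hεV' : ε / (4 * V) ≤ 1 / 4 := by rw [div_le_iff₀ (by positivity)]; linarith
  have habs : |2 * t * v| ≤ 1 / 2 := by
    rw [abs_le]; constructor <;> nlinarith
  have habs' : |2 * (-t) * v| ≤ 1 / 2 := by
    rw [abs_le]; constructor <;> nlinarith
  have hexp : -t * (b.card * ε) + b.card * (2 * (t * v) ^ 2) ≤
      -(b.card * ε ^ 2 / (8 * V ^ 2)) := by
    have h1 : (t * v) ^ 2 ≤ (ε / (4 * V)) ^ 2 := by gcongr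
    have h2 : -(b.card * ε ^ 2 / (8 * V ^ 2)) =
        -t * (b.card * ε) + b.card * (2 * (ε / (4 * V)) ^ 2) := by
      rw [ht]; field_simp; ring
    rw [h2]
    gcongr
  have hsub : {ω | ε ≤ |(b.card : ℝ)⁻¹ * ∑ n ∈ b, Y n ω ^ 2 - v|} ⊆
      {ω | b.card * ε ≤ ∑ n ∈ b, (Y n ω ^ 2 - v)} ∪
        {ω | ∑ n ∈ b, (Y n ω ^ 2 - v) ≤ -(b.card * ε)} := by
    intro ω hω
    have e : (b.card : ℝ)⁻¹ * ∑ n ∈ b, Y n ω ^ 2 - v =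
        (∑ n ∈ b, (Y n ω ^ 2 - v)) / b.card := by
      rw [Finset.sum_sub_distrib, Finset.sum_const, nsmul_eq_mul]
      field_simp
    rw [Set.mem_ofPred_eq, e, le_abs] at hω
    rcases hω with h | h
    · left
      rw [le_div_iff₀ hb'] at h
      rw [Set.mem_ofPred_eq]
      linarith
    · right
      rw [← neg_div, le_div_iff₀ hb'] at h
      rw [Set.mem_ofPred_eq]
      linarith
  obtain ⟨i1, m1⟩ := mgf_sum_sq_gaussian_le hY hind habs b
  obtain ⟨i2, m2⟩ := mgf_sum_sq_gaussian_le hY hind habs' b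
  have u1 := measure_ge_le_exp_mul_mgf (b.card * ε) ht0 i1
  have u2 := measure_le_le_exp_mul_mgf (-(b.card * ε)) (neg_nonpos.2 ht0) i2
  have w1 : Real.exp (-t * (b.card * ε)) * Real.exp (b.card * (2 * (t * v) ^ 2)) ≤
      Real.exp (-(b.card * ε ^ 2 / (8 * V ^ 2))) := by
    rw [← Real.exp_add]; exact Real.exp_le_exp.2 hexp
  calc _ ≤ _ := measureReal_mono hsub
    _ ≤ _ := measureReal_union_le _ _
    _ ≤ Real.exp (-(b.card * ε ^ 2 / (8 * V ^ 2))) + Real.exp (-(b.card * ε ^ 2 / (8 * V ^ 2))) := by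
      refine add_le_add (u1.trans (le_trans ?_ w1)) (u2.trans (le_trans ?_ w1))
      · gcongr
      · have : -(-t) * (-(b.card * ε)) = -t * (b.card * ε) := by ring
        rw [this]
        have m2' := m2
        rw [neg_mul, neg_sq] at m2'
        gcongr
    _ = _ := by ring

theorem hasLaw_inner_multivariateGaussian {p : ℕ} {Sig : Matrix (Fin p) (Fin p) ℝ}
    (hS : Sig.PosSemidef) (x : EuclideanSpace ℝ (Fin p)) :
    HasLaw (fun z => inner ℝ x z) (gaussianReal 0 (x ⬝ᵥ Sig.mulVec x).toNNReal)
      (multivariateGaussian 0 Sig) where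
  aemeasurable := by fun_prop
  map_eq := by
    have h := IsGaussian.map_eq_gaussianReal (μ := multivariateGaussian 0 Sig) (innerSL ℝ x)
    have hcoe : ⇑(innerSL ℝ x) = fun z => inner ℝ x z := by ext z; simp
    have hmean : ∫ z, (innerSL ℝ x) z ∂(multivariateGaussian 0 Sig) = 0 := by
      rw [ContinuousLinearMap.integral_comp_id_comm IsGaussian.integrable_id]
      simp
    have hvar : Var[innerSL ℝ x; multivariateGaussian 0 Sig] = x ⬝ᵥ Sig.mulVec x := by
      rw [← covarianceBilin_multivariateGaussian (μ := 0) hS,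
        covarianceBilin_apply_eq_cov IsGaussian.memLp_two_id, covariance_self (by fun_prop), hcoe]
    rw [hmean, hvar, hcoe] at h
    exact h

/-! ### Deviation of the sample covariance matrix of a random batch -/

/-- Polarization: an entry of the sample covariance matrix is a difference of empirical second
moments of `X_u + X_v` and `X_u - X_v`. -/
theorem sampleCov_sub_eq {p N : ℕ} (x : Fin N → EuclideanSpace ℝ (Fin p)) (b : Finset (Fin N))
    (u v : Fin p) (a c s : ℝ) (h : a - c = 4 * s) :
    sampleCov x b u v - s = (((b.card : ℝ)⁻¹ * ∑ n ∈ b, (x n u + x n v) ^ 2 - a) -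
      ((b.card : ℝ)⁻¹ * ∑ n ∈ b, (x n u - x n v) ^ 2 - c)) / 4 := by
  have : ∑ n ∈ b, (x n u + x n v) ^ 2 =
      ∑ n ∈ b, (x n u - x n v) ^ 2 + 4 * ∑ n ∈ b, x n u * x n v := by
    rw [Finset.mul_sum, ← Finset.sum_add_distrib]
    exact Finset.sum_congr rfl fun n _ => by ring
  rw [this]
  simp only [sampleCov, Matrix.of_apply]
  linear_combination (1 / 4) * h

theorem sampleCov_deviation_le {Ω : Type*} [MeasurableSpace Ω] {P : Measure Ω}
    [IsProbabilityMeasure P] {p N : ℕ} {Sig : Matrix (Fin p) (Fin p) ℝ} (hS : Sig.PosSemidef)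
    {X : Fin N → Ω → EuclideanSpace ℝ (Fin p)}
    (hX : ∀ n, HasLaw (X n) (multivariateGaussian 0 Sig) P) (hind : iIndepFun X P)
    {u v : Fin p} {l ε : ℝ} (hl : 0 < l) (hu : Sig u u ≤ l) (hv : Sig v v ≤ l) (hε : 0 < ε)
    (hεl : ε ≤ 4 * l) {b : Finset (Fin N)} (hb : 0 < b.card) :
    P.real {ω | ε ≤ |sampleCov (fun n => X n ω) b u v - Sig u v|} ≤
      4 * Real.exp (-(b.card * ε ^ 2 / (128 * l ^ 2))) := by
  have hsym : Sig v u = Sig u v := by simpa using hS.isHermitian.apply u v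
  -- the variance of `X_u + σ X_v`, as a quadratic form
  have hq : ∀ σ : ℝ, (EuclideanSpace.single u (1 : ℝ) + σ • EuclideanSpace.single v 1 :
        EuclideanSpace ℝ (Fin p)) ⬝ᵥ
        Sig.mulVec (EuclideanSpace.single u (1 : ℝ) + σ • EuclideanSpace.single v 1 :
        EuclideanSpace ℝ (Fin p)) = Sig u u + 2 * σ * Sig u v + σ ^ 2 * Sig v v := by
    intro σ
    simp only [WithLp.ofLp_add, WithLp.ofLp_smul, PiLp.ofLp_single, Matrix.mulVec_add,
      Matrix.mulVec_smul, Matrix.mulVec_single_one, add_dotProduct, smul_dotProduct,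
      single_one_dotProduct, Pi.add_apply, Pi.smul_apply, smul_eq_mul, Matrix.col_apply, hsym]
    ring
  have hq0 : ∀ σ : ℝ, 0 ≤ Sig u u + 2 * σ * Sig u v + σ ^ 2 * Sig v v := by
    intro σ
    rw [← hq σ]
    simpa only [star_trivial] using hS.dotProduct_mulVec_nonneg
      (EuclideanSpace.single u (1 : ℝ) + σ • EuclideanSpace.single v 1 : EuclideanSpace ℝ (Fin p))
  have hdev : ∀ σ : ℝ, σ ^ 2 = 1 →
      P.real {ω | ε ≤ |(b.card : ℝ)⁻¹ * ∑ n ∈ b, (X n ω u + σ * X n ω v) ^ 2 -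
        (Sig u u + 2 * σ * Sig u v + σ ^ 2 * Sig v v)|} ≤
      2 * Real.exp (-(b.card * ε ^ 2 / (8 * (4 * l) ^ 2))) := by
    intro σ hσ
    have hle : Sig u u + 2 * σ * Sig u v + σ ^ 2 * Sig v v ≤ 4 * l := by
      -- the variances of `X_u + σ X_v` and `X_u - σ X_v` add up to `2 (Σ_uu + Σ_vv)`
      have := hq0 (-σ)
      rw [neg_sq, hσ] at this
      rw [hσ]
      linarith
    have hlaw : ∀ n, HasLaw (fun ω => X n ω u + σ * X n ω v)
        (gaussianReal 0 (Sig u u + 2 * σ * Sig u v + σ ^ 2 * Sig v v).toNNReal) P := by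
      intro n
      have h := (hasLaw_inner_multivariateGaussian hS
        (EuclideanSpace.single u (1 : ℝ) + σ • EuclideanSpace.single v 1)).fun_comp (hX n)
      rw [hq σ] at h
      refine h.congr (Filter.Eventually.of_forall fun ω => ?_)
      simp [inner_add_left, inner_smul_left, EuclideanSpace.inner_single_left]
    have hi : iIndepFun (fun n ω => X n ω u + σ * X n ω v) P :=
      hind.comp (fun _ (z : EuclideanSpace ℝ (Fin p)) => z u + σ * z v) (fun _ => by fun_prop)
    have h := empirical_variance_deviation_le hlaw hi
      (by rwa [Real.coe_toNNReal _ (hq0 σ)]) (by positivity) hε hεl hb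
    rwa [Real.coe_toNNReal _ (hq0 σ)] at h
  have h1 := hdev 1 (by norm_num)
  have h2 := hdev (-1) (by norm_num)
  calc _ ≤ P.real ({ω | ε ≤ |(b.card : ℝ)⁻¹ * ∑ n ∈ b, (X n ω u + 1 * X n ω v) ^ 2 -
        (Sig u u + 2 * 1 * Sig u v + 1 ^ 2 * Sig v v)|} ∪
        {ω | ε ≤ |(b.card : ℝ)⁻¹ * ∑ n ∈ b, (X n ω u + -1 * X n ω v) ^ 2 -
        (Sig u u + 2 * (-1) * Sig u v + (-1) ^ 2 * Sig v v)|}) := by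
        refine measureReal_mono fun ω hω => ?_
        by_contra hcon
        simp only [Set.mem_union, Set.mem_ofPred_eq, not_or, not_le, one_mul, neg_mul,
          ← sub_eq_add_neg] at hcon
        rw [Set.mem_ofPred_eq, sampleCov_sub_eq (fun n => X n ω) b u v
          (Sig u u + 2 * 1 * Sig u v + 1 ^ 2 * Sig v v)
          (Sig u u + 2 * (-1) * Sig u v + (-1) ^ 2 * Sig v v) (Sig u v) (by ring)] at hω
        obtain ⟨a1, a2⟩ := hcon
        rw [abs_lt] at a1 a2
        rcases le_abs.1 hω with h | h <;> linarith [a1.1, a1.2, a2.1, a2.2]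
    _ ≤ _ := measureReal_union_le _ _
    _ ≤ _ := add_le_add h1 h2
    _ = _ := by
        have : 8 * (4 * l) ^ 2 = 128 * l ^ 2 := by ring
        rw [this]; ring

/-- A bound on an event of the data that holds for every fixed batch also holds for a random
batch which is independent of the data. -/
theorem measureReal_random_index_le {Ω E F : Type*} [MeasurableSpace Ω] [MeasurableSpace E]
    [MeasurableSpace F] [MeasurableSingletonClass F] [Fintype F] {P : Measure Ω}
    [IsProbabilityMeasure P] {X : Ω → E} {B : Ω → F} (hind : IndepFun X B P)
    (hB : AEMeasurable B P) {D : F → Set E} (hD : ∀ b, MeasurableSet (D b)) {δ : ℝ}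
    (h : ∀ b, P.real (B ⁻¹' {b}) ≠ 0 → P.real (X ⁻¹' D b) ≤ δ) :
    P.real {ω | X ω ∈ D (B ω)} ≤ δ := by
  have := Measure.isProbabilityMeasure_map hB
  have hsum : ∑ b, P.real (B ⁻¹' {b}) = 1 := by
    have h1 := sum_measureReal_singleton (μ := P.map B) (Finset.univ : Finset F)
    rw [Finset.coe_univ, probReal_univ] at h1
    rw [← h1]
    exact Finset.sum_congr rfl fun b _ =>
      (map_measureReal_apply_of_aemeasurable hB (measurableSet_singleton b)).symm
  calc P.real {ω | X ω ∈ D (B ω)} ≤ P.real (⋃ b, X ⁻¹' D b ∩ B ⁻¹' {b}) := by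
        refine measureReal_mono fun ω hω => ?_
        exact Set.mem_iUnion.2 ⟨B ω, hω, rfl⟩
    _ ≤ ∑ b, P.real (X ⁻¹' D b ∩ B ⁻¹' {b}) := measureReal_iUnion_fintype_le _
    _ ≤ ∑ b, δ * P.real (B ⁻¹' {b}) := by
        refine Finset.sum_le_sum fun b _ => ?_
        rw [measureReal_def, hind.measure_inter_preimage_eq_mul _ _ (hD b)
          (measurableSet_singleton b), ENNReal.toReal_mul, ← measureReal_def, ← measureReal_def]
        by_cases hb : P.real (B ⁻¹' {b}) = 0
        · simp [hb]
        · exact mul_le_mul_of_nonneg_right (h b hb) measureReal_nonneg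
    _ = δ := by rw [← Finset.mul_sum, hsum, mul_one]

theorem measurable_sampleCov {p N : ℕ} (b : Finset (Fin N)) (u v : Fin p) :
    Measurable fun x : Fin N → EuclideanSpace ℝ (Fin p) => sampleCov x b u v := by
  simp only [sampleCov, Matrix.of_apply]
  fun_prop

theorem sampleCov_randomBatch_deviation_le {Ω : Type*} [MeasurableSpace Ω] {P : Measure Ω}
    [IsProbabilityMeasure P] {p N M : ℕ} {Sig : Matrix (Fin p) (Fin p) ℝ} (hS : Sig.PosSemidef)
    {X : Fin N → Ω → EuclideanSpace ℝ (Fin p)}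
    (hX : ∀ n, HasLaw (X n) (multivariateGaussian 0 Sig) P) (hind : iIndepFun X P)
    {B : Ω → Finset (Fin N)} (hB : HasLaw B (uniformOn {b : Finset (Fin N) | b.card = M}) P)
    (hXB : IndepFun (fun ω n => X n ω) B P) (hM : 0 < M)
    {u v : Fin p} {l ε : ℝ} (hl : 0 < l) (hu : Sig u u ≤ l) (hv : Sig v v ≤ l) (hε : 0 < ε)
    (hεl : ε ≤ 4 * l) :
    P.real {ω | ε ≤ |sampleCov (fun n => X n ω) (B ω) u v - Sig u v|} ≤
      4 * Real.exp (-(M * ε ^ 2 / (128 * l ^ 2))) := by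
  refine measureReal_random_index_le
    (D := fun b => {x | ε ≤ |sampleCov x b u v - Sig u v|}) hXB hB.aemeasurable (fun b => ?_)
    fun b hb => ?_
  · exact measurableSet_le measurable_const ((measurable_sampleCov b u v).sub_const _).abs
  · have hcard : b.card = M := by
      by_contra hne
      apply hb
      rw [← map_measureReal_apply_of_aemeasurable hB.aemeasurable (measurableSet_singleton b),
        hB.map_eq, measureReal_def, (uniformOn_eq_zero_iff (Set.toFinite _)).2, ENNReal.toReal_zero]
      ext c
      simp only [Set.mem_inter_iff, Set.mem_ofPred_eq, Set.mem_singleton_iff, Set.mem_empty_iff_false,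
        iff_false, not_and]
      rintro hc rfl
      exact hne hc
    have h := sampleCov_deviation_le hS hX hind hl hu hv hε hεl (b := b) (by omega)
    rwa [hcard] at h

/-! ### Edges whose tests are all positive survive the algorithm -/

theorem le_processPair {p : ℕ} {rho : CITest p → ℝ} {l d : ℕ} (hl : l ≤ d + 1)
    {G H : SimpleGraph (Fin p)}
    (hpos : ∀ t : CITest p, G.Adj t.i t.j → t.i ∉ t.condSet → t.j ∉ t.condSet →
      t.condSet.card ≤ d + 2 → 0 < rho t) (hGH : G ≤ H) (e : Fin p × Fin p) :
    G ≤ processPair rho l H e := by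
  unfold processPair
  split_ifs with h
  · obtain ⟨-, -, S, hS, hcard, k, hkS, hki, hkj, hneg⟩ := h
    have hnot : ¬ G.Adj e.1 e.2 := by
      intro hadj
      refine absurd (hpos ⟨e.1, e.2, S, some k⟩ hadj ?_ ?_ ?_) (not_lt.2 hneg.le)
      · simp only [CITest.condSet, Option.toFinset_some, Finset.mem_union, Finset.mem_singleton,
          not_or]
        refine ⟨fun hmem => ?_, hki.symm⟩
        have := hS hmem
        simp [adjWithout] at this
      · simp only [CITest.condSet, Option.toFinset_some, Finset.mem_union, Finset.mem_singleton,
          not_or]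
        refine ⟨fun hmem => ?_, hkj.symm⟩
        have := hS hmem
        simp [adjWithout] at this
      · refine (Finset.card_union_le _ _).trans ?_
        simp only [Option.toFinset_some, Finset.card_singleton]
        omega
    intro a b hab
    rw [SimpleGraph.deleteEdges_adj]
    refine ⟨hGH hab, fun hmem => hnot ?_⟩
    rw [Set.mem_singleton_iff] at hmem
    rw [← SimpleGraph.mem_edgeSet] at hab ⊢
    rwa [← hmem]
  · exact hGH

theorem le_runIteration {p : ℕ} {rho : CITest p → ℝ} {l d : ℕ} (hl : l ≤ d + 1)
    {G : SimpleGraph (Fin p)}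
    (hpos : ∀ t : CITest p, G.Adj t.i t.j → t.i ∉ t.condSet → t.j ∉ t.condSet →
      t.condSet.card ≤ d + 2 → 0 < rho t) (L : List (Fin p × Fin p)) :
    ∀ H : SimpleGraph (Fin p), G ≤ H → G ≤ runIteration rho l L H := by
  induction L with
  | nil => exact fun H hH => hH
  | cons e L ih => exact fun H hH => ih _ (le_processPair hl hpos hH e)

theorem le_graphAfter {p : ℕ} {rho : CITest p → ℝ} {d : ℕ} {G : SimpleGraph (Fin p)}
    (hpos : ∀ t : CITest p, G.Adj t.i t.j → t.i ∉ t.condSet → t.j ∉ t.condSet →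
      t.condSet.card ≤ d + 2 → 0 < rho t) (order : ℕ → List (Fin p × Fin p)) :
    ∀ l ≤ d + 1, G ≤ graphAfter rho order l := by
  intro l
  induction l with
  | zero => exact fun hl => le_runIteration hl hpos _ _ le_top
  | succ l ih =>
    intro hl
    rw [graphAfter]
    split_ifs
    · exact ih (by omega)
    · exact le_runIteration hl hpos _ _ (ih (by omega))

/-! ### Union bound over the tests -/

/-- The label of a conditional independence test that is encoded by a tuple of nodes; the
conditioning set is the set of the nodes listed by `q.2.2.1`. -/
def testOfCode {p d : ℕ}
    (q : Fin p × Fin p × (Fin (d + 2) → Option (Fin p)) × Option (Fin p)) : CITest p :=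
  ⟨q.1, q.2.1, Finset.univ.filter fun k => ∃ a, q.2.2.1 a = some k, q.2.2.2⟩

theorem exists_testOfCode_eq {p d : ℕ} {t : CITest p} (ht : t.condSet.card ≤ d + 2) :
    ∃ q : Fin p × Fin p × (Fin (d + 2) → Option (Fin p)) × Option (Fin p),
      testOfCode q = t := by
  obtain ⟨i, j, S, k⟩ := t
  refine ⟨⟨i, j, fun a => S.toList[(a : ℕ)]?, k⟩, ?_⟩
  have hS : S.card ≤ d + 2 := (Finset.card_le_card Finset.subset_union_left).trans ht
  simp only [testOfCode, CITest.mk.injEq, true_and, and_true]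
  ext x
  simp only [Finset.mem_filter, Finset.mem_univ, true_and]
  rw [← Finset.mem_toList, List.mem_iff_getElem?]
  constructor
  · rintro ⟨a, ha⟩
    exact ⟨a, ha⟩
  · rintro ⟨n, hn⟩
    obtain ⟨hlt, -⟩ := List.getElem?_eq_some_iff.1 hn
    rw [Finset.length_toList] at hlt
    exact ⟨⟨n, by omega⟩, hn⟩

/-- Failure probability of a single test whose population partial correlation is at least `r`. -/
theorem empPartialCorr_nonpos_le {Ω : Type*} [MeasurableSpace Ω] {P : Measure Ω}
    [IsProbabilityMeasure P] {p N M d : ℕ} {Sig : Matrix (Fin p) (Fin p) ℝ} (hS : Sig.PosDef)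
    {smin smax r : ℝ} (hsmin : 0 < smin) (hsmax : 0 < smax) (hr0 : 0 < r) (hr1 : r ≤ 1)
    (hE : EigenCondition Sig d smin smax)
    {X : Fin N → Ω → EuclideanSpace ℝ (Fin p)} {B : CITest p → Ω → Finset (Fin N)}
    (hX : ∀ n, HasLaw (X n) (multivariateGaussian 0 Sig) P) (hind : iIndepFun X P)
    (hB : ∀ t, HasLaw (B t) (uniformOn {b : Finset (Fin N) | b.card = M}) P)
    (hXB : IndepFun (fun ω n => X n ω) (fun ω t => B t ω) P) (hM : 0 < M) {t : CITest p}
    (ht : t.condSet.card ≤ d + 2) (hr : r ≤ partialCorr Sig t.i t.j t.condSet) :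
    P.real {ω | empPartialCorr (fun n => X n ω) (fun s => B s ω) t ≤ 0} ≤
      4 * ((d : ℝ) + 4) ^ 2 *
        Real.exp (-(M * (smin ^ 2 / (4 * (d + 4) * smax) * r) ^ 2 / (128 * smax ^ 2))) := by
  set T := insert t.i (insert t.j t.condSet) with hT
  have hTcard : T.card ≤ d + 4 := by
    have h1 := Finset.card_insert_le t.i (insert t.j t.condSet)
    have h2 := Finset.card_insert_le t.j t.condSet
    rw [hT]
    omega
  have hev := hE T hTcard
  have hTpd := principalSubmatrix_posDef hS T
  have hdiag : ∀ u ∈ T, Sig u u ≤ smax := fun u hu =>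
    diag_le_of_spectrum hTpd.isHermitian (fun ev he => (hev ev he).2) ⟨u, hu⟩
  have hle : smin ≤ smax := by
    have hi : t.i ∈ T := by simp [hT]
    have h := dotProduct_mulVec_ge_of_spectrum hTpd.isHermitian (fun ev he => (hev ev he).1)
      (Pi.single ⟨t.i, hi⟩ 1)
    rw [Matrix.mulVec_single_one, single_one_dotProduct, single_one_dotProduct,
      Pi.single_eq_same, mul_one] at h
    exact h.trans (hdiag t.i hi)
  set ε := smin ^ 2 / (4 * (d + 4) * smax) * r with hε
  have hεpos : 0 < ε := by positivity
  have hεm : ((d : ℝ) + 4) * ε = smin ^ 2 * r / (4 * smax) := by rw [hε]; field_simp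
  have hεm' : smin ^ 2 * r / (4 * smax) ≤ smin / 4 := by
    rw [div_le_div_iff₀ (by positivity) (by norm_num)]
    nlinarith [mul_le_mul hle hr1 hr0.le hsmax.le]
  have hεl : ε ≤ 4 * smax := by
    have hd : (0 : ℝ) ≤ d := Nat.cast_nonneg d
    nlinarith [mul_nonneg hd hεpos.le]
  have hXBt : IndepFun (fun ω n => X n ω) (B t) P :=
    hXB.comp (φ := id) (ψ := fun g : CITest p → Finset (Fin N) => g t) measurable_id
      (measurable_pi_apply t)
  have hcover : {ω | empPartialCorr (fun n => X n ω) (fun s => B s ω) t ≤ 0} ⊆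
      ⋃ q ∈ T ×ˢ T, {ω | ε ≤ |sampleCov (fun n => X n ω) (B t ω) q.1 q.2 - Sig q.1 q.2|} := by
    intro ω hω
    by_contra hcon
    simp only [Set.mem_iUnion, Set.mem_ofPred_eq, not_exists, not_le, Finset.mem_product,
      Prod.forall] at hcon
    rw [Set.mem_ofPred_eq, ← not_lt] at hω
    refine hω ?_
    refine partialCorr_pos_of_entrywise_close (m := d + 4) hsmin hsmax hr0.le hεpos.le hS ?_ ?_ hev
      (fun u hu v hv => (hcon u v ⟨hu, hv⟩).le) ?_ hr ?_
    · ext u v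
      simp [sampleCov, mul_comm]
    · exact_mod_cast hTcard
    · rw [hεm]; linarith
    · have : 2 * ((d : ℝ) + 4) * ε * smax = smin ^ 2 * r / 2 := by
        rw [mul_assoc 2, hεm]; field_simp; norm_num
      rw [this]
      have : 0 < smin ^ 2 * r := by positivity
      linarith
  have hnum : ((T ×ˢ T).card : ℝ) ≤ ((d : ℝ) + 4) ^ 2 := by
    rw [Finset.card_product, ← sq]
    exact_mod_cast Nat.pow_le_pow_left hTcard 2
  calc _ ≤ _ := measureReal_mono hcover (measure_ne_top _ _)
    _ ≤ _ := measureReal_biUnion_finset_le _ _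
    _ ≤ ∑ _q ∈ T ×ˢ T, 4 * Real.exp (-(M * ε ^ 2 / (128 * smax ^ 2))) := by
        refine Finset.sum_le_sum fun q hq => ?_
        rw [Finset.mem_product] at hq
        exact sampleCov_randomBatch_deviation_le hS.posSemidef hX hind (hB t) hXBt hM hsmax
          (hdiag _ hq.1) (hdiag _ hq.2) hεpos hεl
    _ ≤ _ := by
        rw [Finset.sum_const, nsmul_eq_mul]
        nlinarith [mul_le_mul_of_nonneg_right hnum
          (Real.exp_pos (-(M * ε ^ 2 / (128 * smax ^ 2)))).le]

/-- Rounding costs at most a factor two, as the batch size is a positive integer. -/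
theorem half_rpow_le_batchSize {N M : ℕ} {γ : ℝ} (hγ : 3 / 4 < γ) (hN : 0 < N)
    (hM : |(M : ℝ) - (N : ℝ) ^ γ| < 1) : 0 < M ∧ (N : ℝ) ^ (3 / 4 : ℝ) / 2 ≤ M := by
  have hN1 : (1 : ℝ) ≤ N := by exact_mod_cast hN
  have h1 : (1 : ℝ) ≤ (N : ℝ) ^ γ := Real.one_le_rpow hN1 (by linarith)
  have h2 : (N : ℝ) ^ (3 / 4 : ℝ) ≤ (N : ℝ) ^ γ := Real.rpow_le_rpow_of_exponent_le hN1 hγ.le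
  have h3 := (abs_lt.1 hM).1
  have hM0 : (0 : ℝ) < M := by linarith
  have hM0' : 0 < M := by exact_mod_cast hM0
  have hM1 : (1 : ℝ) ≤ M := by exact_mod_cast hM0'
  exact ⟨hM0', by linarith⟩

/-- The union bound over all tests with at most `d + 2` conditioning nodes, in numbers. -/
theorem card_tests_mul_le {p d : ℕ} (hp : 2 ≤ p) :
    (p * (p * ((p + 1) ^ (d + 2) * (p + 1))) : ℝ) * (4 * ((d : ℝ) + 4) ^ 2) ≤
      (p : ℝ) ^ (2 * d + 8 + 4 * (d + 4) ^ 2) := by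
  have hp' : (2 : ℝ) ≤ p := by exact_mod_cast hp
  have h1 : (p : ℝ) + 1 ≤ (p : ℝ) ^ 2 := by nlinarith
  have h2 : (4 * ((d : ℝ) + 4) ^ 2) ≤ (p : ℝ) ^ (4 * (d + 4) ^ 2) := by
    have h : (4 * (d + 4) ^ 2 : ℕ) ≤ p ^ (4 * (d + 4) ^ 2) := (Nat.lt_pow_self hp).le
    exact_mod_cast h
  calc (p * (p * ((p + 1) ^ (d + 2) * (p + 1))) : ℝ) * (4 * ((d : ℝ) + 4) ^ 2)
      ≤ (p * (p * (((p : ℝ) ^ 2) ^ (d + 2) * (p : ℝ) ^ 2))) * (p : ℝ) ^ (4 * (d + 4) ^ 2) := by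
        gcongr
    _ = _ := by ring

theorem theorem2 (d : ℕ) (smin smax : ℝ) (hsmin : 0 < smin) (hsmax : 0 < smax) :
    ∃ c₀ : ℝ, 0 < c₀ ∧ ∀ c : ℝ, c₀ ≤ c → ∃ τ : ℝ, 0 < τ ∧
      ∀ (γ : ℝ), 3 / 4 < γ → γ < 1 →
      ∀ (p N M : ℕ), 0 < N → M ≤ N → |(M : ℝ) - (N : ℝ) ^ γ| < 1 →
      ∀ (Sig : Matrix (Fin p) (Fin p) ℝ) (G : SimpleGraph (Fin p)) [DecidableRel G.Adj],
        Sig.PosDef →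
        IsMTP2 (gaussianDensity Sig) →
        IsGraphicalModel G (multivariateGaussian 0 Sig) →
        G.maxDegree = d →
        EigenCondition Sig d smin smax →
        SignalCondition Sig G N c →
      ∀ {Ω : Type*} [MeasurableSpace Ω] (P : Measure Ω) [IsProbabilityMeasure P]
        (X : Fin N → Ω → EuclideanSpace ℝ (Fin p)) (B : CITest p → Ω → Finset (Fin N)),
        (∀ n, HasLaw (X n) (multivariateGaussian 0 Sig) P) →
        iIndepFun X P →
        (∀ t, HasLaw (B t) (uniformOn {b : Finset (Fin N) | b.card = M}) P) →
        iIndepFun B P →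
        IndepFun (fun ω n => X n ω) (fun ω t => B t ω) P →
        1 - (p : ℝ) ^ (-τ) ≤
          P.real {ω |
            (∀ t : CITest p, G.Adj t.i t.j → t.i ∉ t.condSet → t.j ∉ t.condSet →
              t.condSet.card ≤ d + 2 →
              0 < empPartialCorr (fun n => X n ω) (fun s => B s ω) t) ∧
            (∀ order : ℕ → List (Fin p × Fin p), IsValidOrder order →
              G ≤ graphAfter (empPartialCorr (fun n => X n ω) (fun s => B s ω)) order (d + 1))} := by
  set a : ℕ := 2 * d + 8 + 4 * (d + 4) ^ 2 with ha
  set κ : ℝ := smin ^ 2 / (4 * (d + 4) * smax) with hκ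
  have hκ0 : 0 < κ := by positivity
  -- `c₀` is chosen so that `c₀² κ² / (256 smax²) = a + 1`, and a single test then fails with
  -- probability `O(p ^ (-(a + 1)))`, while there are `O(p ^ a)` tests
  set c₀ : ℝ := 16 * smax * √(a + 1) / κ with hc₀
  have hc₀pos : 0 < c₀ := by positivity
  refine ⟨c₀, hc₀pos, fun c hc => ⟨1, one_pos, ?_⟩⟩
  intro γ hγ _ p N M hN _ hM Sig G _ hS hMTP _ _ hE hsig Ω _ P _ X B hX hXi hB _ hXB
  by_cases hedge : ∃ i j, G.Adj i j
  swap
  · -- without edges there is nothing to prove; this covers `p ≤ 1`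
    push Not at hedge
    have huniv : {ω | (∀ t : CITest p, G.Adj t.i t.j → t.i ∉ t.condSet → t.j ∉ t.condSet →
              t.condSet.card ≤ d + 2 →
              0 < empPartialCorr (fun n => X n ω) (fun s => B s ω) t) ∧
            (∀ order : ℕ → List (Fin p × Fin p), IsValidOrder order →
              G ≤ graphAfter (empPartialCorr (fun n => X n ω) (fun s => B s ω)) order (d + 1))} =
        Set.univ :=
      Set.eq_univ_of_forall fun ω =>
        ⟨fun t h => absurd h (hedge _ _), fun _ _ i j h => absurd h (hedge i j)⟩
    rw [huniv, probReal_univ]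
    linarith [Real.rpow_nonneg (Nat.cast_nonneg (α := ℝ) p) (-1)]
  obtain ⟨i₀, j₀, hij₀⟩ := hedge
  have hp : 2 ≤ p := by
    have h1 := i₀.2
    have h2 := j₀.2
    have h3 : (i₀ : ℕ) ≠ j₀ := fun h => hij₀.ne (Fin.ext h)
    omega
  have hp' : (2 : ℝ) ≤ p := by exact_mod_cast hp
  have hlog : 0 < Real.log p := Real.log_pos (by linarith)
  have hN' : (0 : ℝ) < (N : ℝ) ^ (3 / 4 : ℝ) :=
    Real.rpow_pos_of_pos (by exact_mod_cast hN) _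
  have hoff : ∀ i j, i ≠ j → Sig⁻¹ i j ≤ 0 := fun i j hij => offDiag_nonpos_of_isMTP2 hS hMTP hij
  obtain ⟨hM0, hMle⟩ := half_rpow_le_batchSize hγ hN hM
  set r : ℝ := c₀ * √(Real.log p / (N : ℝ) ^ (3 / 4 : ℝ)) with hr
  have hr0 : 0 < r := mul_pos hc₀pos (Real.sqrt_pos.2 (div_pos hlog hN'))
  have hrle : ∀ i j, G.Adj i j → ∀ S, r ≤ partialCorr Sig i j S := fun i j hij S =>
    (mul_le_mul_of_nonneg_right hc (Real.sqrt_nonneg _)).trans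
      ((hsig i j hij).trans (partialCorr_compl_le hS hoff hij.ne S))
  have hr1 : r ≤ 1 := (hrle i₀ j₀ hij₀ ∅).trans (partialCorr_le_one hS hij₀.ne _)
  set δ : ℝ := Real.exp (-(M * (κ * r) ^ 2 / (128 * smax ^ 2))) with hδ
  have hδle : δ ≤ ((p : ℝ) ^ (a + 1))⁻¹ := by
    have hr2 : r ^ 2 = c₀ ^ 2 * (Real.log p / (N : ℝ) ^ (3 / 4 : ℝ)) := by
      rw [hr, mul_pow, Real.sq_sqrt (div_pos hlog hN').le]
    have hc2 : c₀ ^ 2 * κ ^ 2 = 256 * smax ^ 2 * (a + 1) := by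
      rw [hc₀, div_pow, mul_pow, mul_pow, Real.sq_sqrt (by positivity)]
      field_simp
      norm_num
    have hexp : ((a : ℝ) + 1) * Real.log p ≤ M * (κ * r) ^ 2 / (128 * smax ^ 2) := by
      calc ((a : ℝ) + 1) * Real.log p =
            (N : ℝ) ^ (3 / 4 : ℝ) / 2 * (κ * r) ^ 2 / (128 * smax ^ 2) := by
            have : (κ * r) ^ 2 = 256 * smax ^ 2 * (a + 1) * (Real.log p / (N : ℝ) ^ (3 / 4 : ℝ)) := by
              rw [mul_pow, hr2, ← hc2]; ring
            rw [this]
            field_simp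
            norm_num
        _ ≤ _ := by gcongr
    have hpow : (p : ℝ) ^ (a + 1) = Real.exp ((a + 1) * Real.log p) := by
      rw [← Real.exp_log (show (0 : ℝ) < p by linarith), ← Real.exp_nat_mul, Real.log_exp]
      push_cast
      rfl
    rw [hpow, ← Real.exp_neg, hδ, Real.exp_le_exp]
    linarith
  set good : Set Ω := {ω | ∀ t : CITest p, G.Adj t.i t.j → t.i ∉ t.condSet → t.j ∉ t.condSet →
      t.condSet.card ≤ d + 2 → 0 < empPartialCorr (fun n => X n ω) (fun s => B s ω) t} with hgood
  classical
  let Q : Finset (Fin p × Fin p × (Fin (d + 2) → Option (Fin p)) × Option (Fin p)) :=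
    Finset.univ.filter fun q => G.Adj (testOfCode q).i (testOfCode q).j ∧
      (testOfCode q).condSet.card ≤ d + 2
  have hbad : goodᶜ ⊆ ⋃ q ∈ Q,
      {ω | empPartialCorr (fun n => X n ω) (fun s => B s ω) (testOfCode q) ≤ 0} := by
    intro ω hω
    simp only [hgood, Set.mem_compl_iff, Set.mem_ofPred_eq, not_forall, not_lt] at hω
    obtain ⟨t, hadj, -, -, hcard, hneg⟩ := hω
    obtain ⟨q, rfl⟩ := exists_testOfCode_eq hcard
    simp only [Set.mem_iUnion]
    exact ⟨q, Finset.mem_filter.2 ⟨Finset.mem_univ _, hadj, hcard⟩, hneg⟩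
  have hQcard : (Q.card : ℝ) ≤ p * (p * ((p + 1) ^ (d + 2) * (p + 1))) := by
    have h := Finset.card_le_univ Q
    simp only [Fintype.card_prod, Fintype.card_fun, Fintype.card_option, Fintype.card_fin] at h
    exact_mod_cast h
  have hbadle : P.real goodᶜ ≤ (p : ℝ) ^ (-1 : ℝ) := by
    calc P.real goodᶜ ≤ _ := measureReal_mono hbad (measure_ne_top _ _)
      _ ≤ _ := measureReal_biUnion_finset_le _ _
      _ ≤ ∑ _q ∈ Q, 4 * ((d : ℝ) + 4) ^ 2 * δ := by
          refine Finset.sum_le_sum fun q hq => ?_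
          obtain ⟨-, hadj, hcard⟩ := Finset.mem_filter.1 hq
          exact empPartialCorr_nonpos_le hS hsmin hsmax hr0 hr1 hE hX hXi hB hXB hM0 hcard
            (hrle _ _ hadj _)
      _ = Q.card * (4 * ((d : ℝ) + 4) ^ 2) * δ := by
          rw [Finset.sum_const, nsmul_eq_mul]; ring
      _ ≤ (p : ℝ) ^ a * ((p : ℝ) ^ (a + 1))⁻¹ := by
          gcongr
          exact (mul_le_mul_of_nonneg_right hQcard (by positivity)).trans (card_tests_mul_le hp)
      _ = (p : ℝ) ^ (-1 : ℝ) := by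
          rw [Real.rpow_neg_one, pow_succ]
          field_simp
  have hone : 1 ≤ P.real good + P.real goodᶜ := by
    rw [← probReal_univ (μ := P), ← Set.union_compl_self good]
    exact measureReal_union_le _ _
  have hsub : good ⊆ {ω | (∀ t : CITest p, G.Adj t.i t.j → t.i ∉ t.condSet → t.j ∉ t.condSet →
              t.condSet.card ≤ d + 2 →
              0 < empPartialCorr (fun n => X n ω) (fun s => B s ω) t) ∧
            (∀ order : ℕ → List (Fin p × Fin p), IsValidOrder order →
              G ≤ graphAfter (empPartialCorr (fun n => X n ω) (fun s => B s ω)) order (d + 1))} :=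
    fun ω hω => ⟨hω, fun order _ => le_graphAfter hω order _ le_rfl⟩
  have := measureReal_mono (μ := P) hsub
  linarith
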